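/- Let $d\in\{1,2,3\}$, let $D\subseteq\mathbb{R}^d$ be open, bounded and connected (and nonempty), and let $X=L^2(D;\mathbb{R})$. Let $\nu\in(0,\infty)\setminus\mathbb{N}$, $\ell\in(0,\infty)$, $\sigma\in(0,\infty)$, and let $N_{\mathrm{lin}}$ be an even natural number. For $z\ge 0$ put $$c(\nu,\ell,\sigma,N_{\mathrm{lin}})(z)=\frac{\sigma^2\pi\csc(\pi\nu)}{\Gamma(\nu)}\sum_{k=1}^{N_{\mathrm{lin}}/2}\left(\frac{(\sqrt{\nu}\,z/\ell)^{2k-2}}{2^{k-1}\,\Gamma(k-\nu)\,(k-1)!}-\frac{(\sqrt{\nu}\,z/\ell)^{2\nu+2k-2}}{2^{k+\nu-1}\,\Gamma(k+\nu)\,(k-1)!}\right),$$ and define the linearised Matérn-type integral operator $\widetilde{\mathcal C}(\nu,\ell,\sigma,N_{\mathrm{lin}}):X\to X$ by $$\bigl(\widetilde{\mathcal C}(\nu,\ell,\sigma,N_{\mathrm{lin}})\varphi\bigr)(y)=\int_D\varphi(x)\,c(\nu,\ell,\sigma,N_{\mathrm{lin}})(|x-y|)\,\mathrm{d}x\qquad(y\in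 D),$$ where $|\cdot|$ is the Euclidean norm. Then $\widetilde{\mathcal C}(\nu,\ell,\sigma,N_{\mathrm{lin}})$ is continuous, self-adjoint and trace-class, i.e. $|\widetilde{\mathcal C}|=(\widetilde{\mathcal C}^*\widetilde{\mathcal C})^{1/2}$ has finite trace. -/

import Mathlib

open MeasureTheory

namespace Matern

/-- The space `L²(D; ℝ)` with respect to Lebesgue measure on `D ⊆ ℝ^d`. -/
abbrev L2 {d : ℕ} (D : Set (EuclideanSpace ℝ (Fin d))) : Type :=
  Lp ℝ 2 (volume.restrict D)

/-- The `N`-term truncation of the Matérn covariance kernel, as a function of the distance `z`. -/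
noncomputable def kernel (ν ℓ σ : ℝ) (N : ℕ) (z : ℝ) : ℝ :=
  σ ^ 2 * Real.pi * (1 / Real.sin (Real.pi * ν)) / Real.Gamma ν *
    ∑ k ∈ Finset.Icc 1 (N / 2),
      ((Real.sqrt ν * z / ℓ) ^ (2 * k - 2) /
          (2 ^ (k - 1) * Real.Gamma ((k : ℝ) - ν) * (Nat.factorial (k - 1) : ℝ))
        - (Real.sqrt ν * z / ℓ) ^ (2 * ν + 2 * (k : ℝ) - 2) /
          ((2 : ℝ) ^ ((k : ℝ) + ν - 1) * Real.Gamma ((k : ℝ) + ν) *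
            (Nat.factorial (k - 1) : ℝ)))

theorem continuous_kernel {ν : ℝ} (hν : 0 < ν) (ℓ σ : ℝ) (N : ℕ) :
    Continuous (kernel ν ℓ σ N) := by
  unfold kernel
  refine continuous_const.mul (continuous_finsetSum _ fun k hk => ?_)
  have hk1 : (1 : ℝ) ≤ k := by exact_mod_cast (Finset.mem_Icc.1 hk).1
  refine Continuous.sub (by fun_prop) (Continuous.div_const ?_ _)
  exact Continuous.rpow_const (by fun_prop) fun z => Or.inr (by linarith)

section IntegralOperator

variable {d : ℕ} {D : Set (EuclideanSpace ℝ (Fin d))}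

theorem isFiniteMeasure_restrict (hD : Bornology.IsBounded D) :
    IsFiniteMeasure (volume.restrict D) :=
  ⟨by simpa using hD.measure_lt_top⟩

theorem exists_bound (hD : Bornology.IsBounded D)
    {κ : EuclideanSpace ℝ (Fin d) → EuclideanSpace ℝ (Fin d) → ℝ}
    (hκ : Continuous (Function.uncurry κ)) :
    ∃ M : ℝ, ∀ x ∈ closure D, ∀ y ∈ closure D, ‖κ x y‖ ≤ M := by
  have hc : IsCompact (closure D ×ˢ closure D) := hD.isCompact_closure.prod hD.isCompact_closure
  obtain ⟨M, hM⟩ := hc.exists_bound_of_continuousOn hκ.continuousOn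
  exact ⟨M, fun x hx y hy => hM (x, y) ⟨hx, hy⟩⟩

theorem ae_mem_closure : ∀ᵐ x ∂(volume.restrict D), x ∈ closure D := by
  have h := ae_restrict_mem (μ := (volume : Measure (EuclideanSpace ℝ (Fin d))))
    (isClosed_closure (s := D)).measurableSet
  exact (ae_mono (Measure.restrict_mono subset_closure le_rfl)) h

theorem integrable_L2 (hD : Bornology.IsBounded D) (φ : L2 D) :
    Integrable (φ : EuclideanSpace ℝ (Fin d) → ℝ) (volume.restrict D) := by
  haveI := isFiniteMeasure_restrict hD
  exact (Lp.memLp φ).integrable (by norm_num)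

/-- The integral defining the operator converges at every point `y` of `D`. -/
theorem integrable_mul_kernel (hD : Bornology.IsBounded D)
    {κ : EuclideanSpace ℝ (Fin d) → EuclideanSpace ℝ (Fin d) → ℝ}
    (hκ : Continuous (Function.uncurry κ)) (φ : L2 D)
    {y : EuclideanSpace ℝ (Fin d)} (hy : y ∈ closure D) :
    Integrable (fun x => φ x * κ x y) (volume.restrict D) := by
  obtain ⟨M, hM⟩ := exists_bound hD hκ
  refine (integrable_L2 hD φ).mul_bdd (c := M) ?_ ?_
  · have : Continuous fun x => κ x y := hκ.comp (by fun_prop : Continuous fun x => (x, y))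
    exact this.aestronglyMeasurable
  · filter_upwards [ae_mem_closure] with x hx using hM x hx y hy

/-- The integral transform of an `L²` function is again in `L²`. -/
theorem memLp_integral (hD : Bornology.IsBounded D)
    {κ : EuclideanSpace ℝ (Fin d) → EuclideanSpace ℝ (Fin d) → ℝ}
    (hκ : Continuous (Function.uncurry κ)) (φ : L2 D) :
    MemLp (fun y => ∫ x in D, φ x * κ x y) 2 (volume.restrict D) := by
  haveI := isFiniteMeasure_restrict hD
  obtain ⟨M, hM⟩ := exists_bound hD hκ
  refine MemLp.of_bound ?_ (∫ x in D, ‖φ x‖ * M) ?_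
  · have h1 : StronglyMeasurable
        (fun p : EuclideanSpace ℝ (Fin d) × EuclideanSpace ℝ (Fin d) =>
          φ p.2 * κ p.2 p.1) := by
      refine ((Lp.stronglyMeasurable φ).comp_measurable measurable_snd).mul ?_
      exact (hκ.comp continuous_swap).stronglyMeasurable
    exact (h1.integral_prod_right (ν := volume.restrict D)).aestronglyMeasurable
  · filter_upwards [ae_mem_closure] with y hy
    refine norm_integral_le_of_norm_le ((integrable_L2 hD φ).norm.mul_const M) ?_
    filter_upwards [ae_mem_closure] with x hx
    rw [norm_mul]
    exact mul_le_mul_of_nonneg_left (hM x hx y hy) (norm_nonneg _)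

/-- The integral operator `φ ↦ ∫_D φ(x) κ(x, ·) dx` on `L²(D; ℝ)`, for a bounded set `D` and a
continuous kernel `κ`, as a linear map (no continuity is built in). -/
noncomputable def integralOperator (hD : Bornology.IsBounded D)
    (κ : EuclideanSpace ℝ (Fin d) → EuclideanSpace ℝ (Fin d) → ℝ)
    (hκ : Continuous (Function.uncurry κ)) : L2 D →ₗ[ℝ] L2 D where
  toFun φ := (memLp_integral hD hκ φ).toLp (fun y => ∫ x in D, φ x * κ x y)
  map_add' φ ψ := by
    rw [← MemLp.toLp_add, MemLp.toLp_eq_toLp_iff]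
    filter_upwards [ae_mem_closure] with y hy
    rw [Pi.add_apply, ← integral_add (integrable_mul_kernel hD hκ φ hy)
      (integrable_mul_kernel hD hκ ψ hy)]
    refine integral_congr_ae ?_
    filter_upwards [Lp.coeFn_add φ ψ] with x hx
    rw [hx, Pi.add_apply, add_mul]
  map_smul' a φ := by
    rw [RingHom.id_apply, ← MemLp.toLp_const_smul, MemLp.toLp_eq_toLp_iff]
    refine Filter.Eventually.of_forall fun y => ?_
    simp only [Pi.smul_apply, smul_eq_mul]
    rw [← integral_const_mul]
    refine integral_congr_ae ?_
    filter_upwards [Lp.coeFn_smul a φ] with x hx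
    rw [hx, Pi.smul_apply, smul_eq_mul, mul_assoc]

end IntegralOperator

theorem continuous_kernel_dist {d : ℕ} {ν : ℝ} (hν : 0 < ν) (ℓ σ : ℝ) (N : ℕ) :
    Continuous (Function.uncurry
      fun x y : EuclideanSpace ℝ (Fin d) => kernel ν ℓ σ N (dist x y)) :=
  (continuous_kernel hν ℓ σ N).comp continuous_dist

/-- The linearised Matérn-type operator
`φ ↦ ∫_D φ(x) c(ν, ℓ, σ, N)(dist(x, ·)) dx` on `L²(D; ℝ)`. -/
noncomputable def linearisedOperator {d : ℕ} {D : Set (EuclideanSpace ℝ (Fin d))}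
    (hD : Bornology.IsBounded D) {ν : ℝ} (hν : 0 < ν) (ℓ σ : ℝ) (N : ℕ) :
    L2 D →ₗ[ℝ] L2 D :=
  integralOperator hD (fun x y => kernel ν ℓ σ N (dist x y)) (continuous_kernel_dist hν ℓ σ N)

/-- A bounded operator `T` on a real Hilbert space is trace-class if its absolute value
`|T| = (T* T)^{1/2}` (the unique positive operator `P` with `P² = T* T`) has finite trace, that is,
`∑ ⟨|T| eᵢ, eᵢ⟩ < ∞` for an orthonormal basis `(eᵢ)`; the sum, which has nonnegative terms, does
not depend on the basis. -/
def IsTraceClass {H : Type*} [NormedAddCommGroup H] [InnerProductSpace ℝ H] [CompleteSpace H]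
    (T : H →L[ℝ] H) : Prop :=
  ∃ P : H →L[ℝ] H, P.IsPositive ∧ P ∘L P = (ContinuousLinearMap.adjoint T) ∘L T ∧
    ∃ (w : Set H) (e : HilbertBasis w ℝ H), Summable fun i => inner ℝ (P (e i)) (e i)

end Matern

/-! The kernel is a finite combination of $|x-y|^{2m}$ and $|x-y|^{2\nu+2m}$. Call a kernel nuclear
if $\sum_i|\langle Te_i,e_i\rangle|$ is bounded over all orthonormal families, even after
multiplication by continuous functions of $x$ and of $y$. Nuclear kernels are closed under sums and
under multiplication by polynomials in $x$ and $y$, in particular by $|x-y|^2$. Starting from the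
constant kernel this gives the even powers. With $n=\lfloor\nu\rfloor$, the other powers reduce to
$|x-y|^s$ with $s=2(\nu-n)\in(0,2)$; this is where $\nu\notin\mathbb{N}$ enters.

For $|x-y|^s$ the key is `sum_abs_form_gaussian_le`: a Gaussian $e^{-t|x-y|^2}$ is a superposition
over $z$ of rank-one kernels $u_z(x)u_z(y)$, so Bessel's inequality for each $z$, integrated over
$z$, gives a bound that does not depend on $t$. Hence every average of Gaussians against an
integrable weight in $t$ is nuclear, and the Gamma integral writes $|x-y|^s$ through such averages
(`Gamma_mul_rpow_eq`).

Finally, the operator is symmetric and Hilbert-Schmidt, hence compact and diagonalisable. Nuclearity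
on an eigenbasis makes the eigenvalues absolutely summable, so $|T|$ has finite trace
(`isTraceClass_of_isCompactOperator`). -/

namespace Matern

/-! ### Compact symmetric operators and the trace-class criterion. -/

section Hilbert

variable {H : Type*} [NormedAddCommGroup H] [InnerProductSpace ℝ H] [CompleteSpace H]

/-- A bounded operator whose squared norms are summable along a Hilbert basis is compact. -/
theorem isCompactOperator_of_summable_norm_sq {ι : Type*} (b : HilbertBasis ι ℝ H) (T : H →L[ℝ] H)
    (hT : Summable fun i => ‖T (b i)‖ ^ 2) : IsCompactOperator T := by
  classical
  -- Finite-rank truncations of `T` along the basis; they converge to `T` in operator norm.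
  let R : Finset ι → H →L[ℝ] H := fun s =>
    ∑ i ∈ s, (innerSL ℝ (b i)).smulRight (T (b i))
  have hR : ∀ s h, R s h = ∑ i ∈ s, inner ℝ (b i) h • T (b i) := fun s h => by
    simp [R]
  have hRc : ∀ s, IsCompactOperator (R s) := fun s => by
    refine Submodule.sum_mem (compactOperator (RingHom.id ℝ) H H) (t := s)
      (f := fun i => (innerSL ℝ (b i)).smulRight (T (b i))) fun i _ => ?_
    change IsCompactOperator _
    have h1 : IsCompactOperator (innerSL ℝ (b i)) :=
      ⟨Metric.closedBall 0 1, isCompact_closedBall _ _,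
        (innerSL ℝ (b i)).continuous.continuousAt.preimage_mem_nhds
          (by simpa using Metric.closedBall_mem_nhds (0 : ℝ) one_pos)⟩
    exact h1.clm_comp ((1 : ℝ →L[ℝ] ℝ).smulRight (T (b i)))
  have hsum : ∀ h, HasSum (fun i => inner ℝ (b i) h • T (b i)) (T h) := fun h => by
    have := (b.hasSum_repr h).mapL T
    simpa [b.repr_apply_apply] using this
  refine isCompactOperator_of_tendsto (l := Filter.atTop) (F := R) ?_
    (Filter.Eventually.of_forall hRc)
  rw [Metric.tendsto_atTop]
  intro ε hε
  obtain ⟨F, hF⟩ := summable_iff_vanishing_norm.1 hT ((ε / 2) ^ 2) (by positivity)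
  refine ⟨F, fun s hs => ?_⟩
  rw [dist_comm, dist_eq_norm]
  refine (ContinuousLinearMap.opNorm_le_bound _ (half_pos hε).le fun h => ?_).trans_lt
    (half_lt_self hε)
  rw [sub_apply, hR]
  refine le_of_tendsto ((hsum h).sub_const (∑ i ∈ s, inner ℝ (b i) h • T (b i))).norm ?_
  filter_upwards [Filter.eventually_ge_atTop s] with G hG
  rw [← Finset.sum_sdiff_eq_sub hG]
  have hd : Disjoint (G \ s) F := Finset.sdiff_disjoint.mono_right hs
  have h1 : ∑ i ∈ G \ s, ‖T (b i)‖ ^ 2 ≤ (ε / 2) ^ 2 := by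
    have := hF _ hd
    rw [Real.norm_of_nonneg (Finset.sum_nonneg fun _ _ => by positivity)] at this
    exact this.le
  have h2 : ∑ i ∈ G \ s, ‖inner ℝ (b i) h‖ ^ 2 ≤ ‖h‖ ^ 2 :=
    b.orthonormal.sum_inner_products_le h
  -- Cauchy-Schwarz: Bessel controls the coefficients of `h`, and the small tail controls the
  -- vectors `T (b i)`.
  calc ‖∑ i ∈ G \ s, inner ℝ (b i) h • T (b i)‖
      ≤ ∑ i ∈ G \ s, ‖inner ℝ (b i) h‖ * ‖T (b i)‖ :=
        norm_sum_le_of_le _ fun i _ => (norm_smul _ _).le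
    _ ≤ ε / 2 * ‖h‖ := by
        refine abs_le_of_sq_le_sq' ?_ (by positivity) |>.2
        refine (Finset.sum_mul_sq_le_sq_mul_sq _ _ _).trans ?_
        rw [mul_pow, mul_comm ((ε / 2) ^ 2)]
        exact mul_le_mul h2 h1 (Finset.sum_nonneg fun _ _ => by positivity) (by positivity)

/-- A compact symmetric operator is diagonalised by some Hilbert basis. -/
theorem exists_hilbertBasis_eigenvectors {T : H →L[ℝ] H} (hTc : IsCompactOperator T)
    (hT : (T : H →ₗ[ℝ] H).IsSymmetric) :
    ∃ (w : Set H) (e : HilbertBasis w ℝ H) (c : w → ℝ), ∀ i, T (e i) = c i • e i := by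
  have hcomplete : ∀ r : ℝ, CompleteSpace (Module.End.eigenspace (T : H →ₗ[ℝ] H) r) := fun r => by
    have : IsClosed (Module.End.eigenspace (T : H →ₗ[ℝ] H) r : Set H) := by
      have h : (Module.End.eigenspace (T : H →ₗ[ℝ] H) r : Set H) = {x | T x = r • x} := by
        ext x
        simp
      rw [h]
      exact isClosed_eq T.continuous (continuous_const_smul r)
    exact this.completeSpace_coe
  choose w b hb using fun r : ℝ => exists_hilbertBasis ℝ (Module.End.eigenspace (T : H →ₗ[ℝ] H) r)
  let v : (Σ r : ℝ, w r) → H := fun p => (b p.1 p.2 : H)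
  have hv : Orthonormal ℝ v :=
    hT.orthogonalFamily_eigenspaces.orthonormal_sigma_orthonormal
      (v_family := fun r => b r) fun r => (b r).orthonormal
  have hTv : ∀ p, T (v p) = p.1 • v p := fun p =>
    Module.End.mem_eigenspace_iff.1 (b p.1 p.2).2
  -- A vector orthogonal to all the eigenvectors is orthogonal to every eigenspace (`r = 0`
  -- included), hence zero by the spectral theorem.
  have hspan : (Submodule.span ℝ (Set.range v))ᗮ = ⊥ := by
    rw [eq_bot_iff, ← ContinuousLinearMap.orthogonalComplement_iSup_eigenspaces_eq_bot hTc hT,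
      ← Submodule.iInf_orthogonal]
    refine le_iInf fun r x hx => ?_
    rw [Submodule.mem_orthogonal] at hx ⊢
    intro u hu
    have hsum := ((b r).hasSum_repr ⟨u, hu⟩).mapL (Submodule.subtypeL _)
    have hsum' := hsum.mapL (innerSL ℝ x)
    rw [real_inner_comm]
    refine hsum'.unique ?_
    convert! hasSum_zero using 2 with i
    have h0 : inner ℝ x (b r i : H) = 0 := by
      rw [real_inner_comm]
      exact hx _ (Submodule.subset_span ⟨⟨r, i⟩, rfl⟩)
    simp [h0]
  -- Reindexing by the range makes the index type a `Set H`, as `IsTraceClass` requires.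
  have hv' := hv.toSubtypeRange
  have hspan' : (Submodule.span ℝ (Set.range (Subtype.val : Set.range v → H)))ᗮ = ⊥ := by
    rwa [Subtype.range_coe]
  refine ⟨Set.range v, HilbertBasis.mkOfOrthogonalEqBot hv' hspan', fun i => i.2.choose.1,
    fun i => ?_⟩
  rw [HilbertBasis.coe_mkOfOrthogonalEqBot]
  have := hTv i.2.choose
  rwa [i.2.choose_spec] at this

/-- On an eigenbasis $\langle Te_i,e_i\rangle$ is the eigenvalue $c_i$, so `hC` gives $\sum|c_i|\le
C$. The bound is asked of every orthonormal family because the eigenbasis is only found inside the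
proof. -/
theorem isTraceClass_of_isCompactOperator {T : H →L[ℝ] H} (hTc : IsCompactOperator T)
    (hT : (T : H →ₗ[ℝ] H).IsSymmetric) {C : ℝ}
    (hC : ∀ (w : Set H) (e : w → H), Orthonormal ℝ e → ∀ s : Finset w,
      ∑ i ∈ s, |inner ℝ (T (e i)) (e i)| ≤ C) : IsTraceClass T := by
  obtain ⟨w, e, c, hc⟩ := exists_hilbertBasis_eigenvectors hTc hT
  have hself : ∀ i, inner ℝ (e i) (e i) = 1 := fun i => by
    rw [real_inner_self_eq_norm_sq, e.orthonormal.1 i, one_pow]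
  have hsc : Summable fun i => |c i| := by
    refine summable_of_sum_le (c := C) (fun i => abs_nonneg _) fun s => ?_
    refine le_of_eq_of_le (Finset.sum_congr rfl fun i _ => ?_) (hC w e e.orthonormal s)
    rw [hc, inner_smul_left, hself]
    simp
  have hsP : Summable fun i => |c i| • (innerSL ℝ (e i)).smulRight (e i) := by
    refine Summable.of_norm_bounded hsc fun i => ?_
    rw [norm_smul, ContinuousLinearMap.norm_smulRight_apply, innerSL_apply_norm, e.orthonormal.1 i]
    simp
  -- The absolute value of `T`; the series converges in operator norm.
  let P : H →L[ℝ] H := ∑' i, |c i| • (innerSL ℝ (e i)).smulRight (e i)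
  have hP : ∀ h, HasSum (fun i => |c i| • inner ℝ (e i) h • e i) (P h) := fun h => by
    simpa using hsP.hasSum.mapL (ContinuousLinearMap.apply ℝ H h)
  have hPi : ∀ h k, HasSum (fun i => |c i| * (inner ℝ (e i) h * inner ℝ (e i) k))
      (inner ℝ k (P h)) := fun h k => by
    simpa [real_inner_comm k] using (hP h).mapL (innerSL ℝ k)
  have hPe : ∀ i, P (e i) = |c i| • e i := fun i => by
    have h := hasSum_single (f := fun j => |c j| • inner ℝ (e j) (e i) • e j) i fun j hj => by
      rw [e.orthonormal.2 hj, zero_smul, smul_zero]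
    rw [(hP (e i)).unique h, hself, one_smul]
  have hsym : (P : H →ₗ[ℝ] H).IsSymmetric := fun h k => by
    change inner ℝ (P h) k = inner ℝ h (P k)
    rw [real_inner_comm]
    refine (hPi h k).unique ?_
    simpa only [mul_comm (inner ℝ (e _) h)] using hPi k h
  refine ⟨P, ?_, ?_, w, e, ?_⟩
  · rw [ContinuousLinearMap.isPositive_iff]
    refine ⟨hsym, fun h => ?_⟩
    rw [real_inner_comm]
    exact (hPi h h).nonneg fun i => mul_nonneg (abs_nonneg _) (mul_self_nonneg _)
  · have hadj : ContinuousLinearMap.adjoint T = T := hT.isSelfAdjoint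
    rw [hadj]
    refine ContinuousLinearMap.ext_on
      (Submodule.dense_iff_topologicalClosure_eq_top.2 e.dense_span) ?_
    rintro _ ⟨i, rfl⟩
    simp [hPe, hc, smul_smul]
  · refine hsc.congr fun i => ?_
    rw [hPe, inner_smul_left, hself]
    simp

end Hilbert

/-! ### Nuclear kernels and their closure properties. -/

section NuclearKernel

variable {d : ℕ} {D : Set (EuclideanSpace ℝ (Fin d))}

theorem exists_bound_single (hD : Bornology.IsBounded D) {g : EuclideanSpace ℝ (Fin d) → ℝ}
    (hg : Continuous g) : ∃ M : ℝ, ∀ᵐ x ∂(volume.restrict D), ‖g x‖ ≤ M := by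
  obtain ⟨M, hM⟩ := hD.isCompact_closure.exists_bound_of_continuousOn hg.continuousOn
  exact ⟨M, ae_mem_closure.mono hM⟩

theorem memLp_continuous (hD : Bornology.IsBounded D) {g : EuclideanSpace ℝ (Fin d) → ℝ}
    (hg : Continuous g) : MemLp g 2 (volume.restrict D) := by
  have := isFiniteMeasure_restrict hD
  obtain ⟨M, hM⟩ := exists_bound_single hD hg
  exact MemLp.of_bound hg.aestronglyMeasurable M hM

theorem integrable_L2_mul (hD : Bornology.IsBounded D) (φ : L2 D)
    {g : EuclideanSpace ℝ (Fin d) → ℝ} (hg : Continuous g) :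
    Integrable (fun x => φ x * g x) (volume.restrict D) := by
  obtain ⟨M, hM⟩ := exists_bound_single hD hg
  exact (integrable_L2 hD φ).mul_bdd hg.aestronglyMeasurable hM

/-- Bessel's inequality, tested against a continuous function. -/
theorem sum_sq_integral_mul_le (hD : Bornology.IsBounded D) {ι : Type*} {e : ι → L2 D}
    (he : Orthonormal ℝ e) (s : Finset ι) {g : EuclideanSpace ℝ (Fin d) → ℝ} (hg : Continuous g) :
    ∑ i ∈ s, (∫ x in D, e i x * g x) ^ 2 ≤ ∫ x in D, g x ^ 2 := by
  have hL := memLp_continuous hD hg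
  have h1 : ∀ i, inner ℝ (e i) (hL.toLp g) = ∫ x in D, e i x * g x := fun i => by
    rw [L2.inner_def]
    refine integral_congr_ae ?_
    filter_upwards [hL.coeFn_toLp] with x hx
    rw [hx, real_inner_comm]
    simp
  have h2 : ‖hL.toLp g‖ ^ 2 = ∫ x in D, g x ^ 2 := by
    rw [← real_inner_self_eq_norm_sq, L2.inner_def]
    refine integral_congr_ae ?_
    filter_upwards [hL.coeFn_toLp] with x hx
    simp [hx, sq]
  rw [← h2]
  refine le_of_eq_of_le (Finset.sum_congr rfl fun i _ => ?_) (he.sum_inner_products_le (s := s) _)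
  rw [h1, Real.norm_eq_abs, sq_abs]

/-- The integrand of the bilinear form of a kernel `k`, weighted by the multipliers `a`, `b`. -/
noncomputable def formIntegrand (a b : EuclideanSpace ℝ (Fin d) → ℝ)
    (k : EuclideanSpace ℝ (Fin d) → EuclideanSpace ℝ (Fin d) → ℝ) (φ ψ : L2 D)
    (p : EuclideanSpace ℝ (Fin d) × EuclideanSpace ℝ (Fin d)) : ℝ :=
  (φ p.1 * a p.1) * (ψ p.2 * b p.2) * k p.1 p.2

/-- The bilinear form of a kernel `k`, weighted by the multipliers `a`, `b`. -/
noncomputable def form (a b : EuclideanSpace ℝ (Fin d) → ℝ)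
    (k : EuclideanSpace ℝ (Fin d) → EuclideanSpace ℝ (Fin d) → ℝ) (φ ψ : L2 D) : ℝ :=
  ∫ p, formIntegrand a b k φ ψ p ∂((volume.restrict D).prod (volume.restrict D))

/-- The kernel `k` defines a form whose diagonal is absolutely summable, with a uniform bound, along
orthonormal families, also after multiplication by continuous functions in each variable. -/
def IsNuclearKernel (D : Set (EuclideanSpace ℝ (Fin d)))
    (k : EuclideanSpace ℝ (Fin d) → EuclideanSpace ℝ (Fin d) → ℝ) : Prop :=
  ∀ a b : EuclideanSpace ℝ (Fin d) → ℝ, Continuous a → Continuous b →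
    (∀ φ ψ : L2 D, Integrable (formIntegrand a b k φ ψ)
      ((volume.restrict D).prod (volume.restrict D))) ∧
    ∃ C : ℝ, ∀ (ι : Type) (e : ι → L2 D), Orthonormal ℝ e → ∀ s : Finset ι,
      ∑ i ∈ s, |form a b k (e i) (e i)| ≤ C

namespace IsNuclearKernel

variable {k k' : EuclideanSpace ℝ (Fin d) → EuclideanSpace ℝ (Fin d) → ℝ}

theorem add (hk : IsNuclearKernel D k) (hk' : IsNuclearKernel D k') :
    IsNuclearKernel D (fun x y => k x y + k' x y) := by
  intro a b ha hb
  obtain ⟨hi, C, hC⟩ := hk a b ha hb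
  obtain ⟨hi', C', hC'⟩ := hk' a b ha hb
  have h : ∀ φ ψ : L2 D, formIntegrand a b (fun x y => k x y + k' x y) φ ψ =
      fun p => formIntegrand a b k φ ψ p + formIntegrand a b k' φ ψ p := fun φ ψ => by
    funext p
    simp only [formIntegrand]
    ring
  refine ⟨fun φ ψ => by rw [h]; exact (hi φ ψ).add (hi' φ ψ), C + C', fun ι e he s => ?_⟩
  refine le_trans ?_ (add_le_add (hC ι e he s) (hC' ι e he s))
  rw [← Finset.sum_add_distrib]
  refine Finset.sum_le_sum fun i _ => ?_
  rw [form, h, integral_add (hi _ _) (hi' _ _)]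
  exact abs_add_le _ _

/-- The factors are absorbed into the multipliers `a` and `b`; this is why `IsNuclearKernel`
quantifies over them. -/
theorem mul_left_right (hk : IsNuclearKernel D k) {f g : EuclideanSpace ℝ (Fin d) → ℝ}
    (hf : Continuous f) (hg : Continuous g) :
    IsNuclearKernel D (fun x y => f x * g y * k x y) := by
  intro a b ha hb
  have h : ∀ φ ψ : L2 D, formIntegrand a b (fun x y => f x * g y * k x y) φ ψ =
      formIntegrand (fun x => a x * f x) (fun x => b x * g x) k φ ψ := fun φ ψ => by
    funext p
    simp only [formIntegrand]
    ring
  simp only [form, h]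
  exact hk _ _ (ha.mul hf) (hb.mul hg)

theorem const_mul (hk : IsNuclearKernel D k) (c : ℝ) :
    IsNuclearKernel D (fun x y => c * k x y) := by
  simpa using hk.mul_left_right (f := fun _ => c) (g := fun _ => 1) continuous_const
    continuous_const

theorem zero : IsNuclearKernel D (fun _ _ => 0) := by
  intro a b _ _
  have h : ∀ φ ψ : L2 D, formIntegrand a b (fun _ _ => 0) φ ψ = fun _ => 0 := fun φ ψ => by
    funext p
    simp [formIntegrand]
  refine ⟨fun φ ψ => ?_, 0, fun ι e _ s => ?_⟩ <;> simp [form, h]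

theorem sum {ι : Type*} (s : Finset ι)
    {κ : ι → EuclideanSpace ℝ (Fin d) → EuclideanSpace ℝ (Fin d) → ℝ}
    (hκ : ∀ i ∈ s, IsNuclearKernel D (κ i)) : IsNuclearKernel D (fun x y => ∑ i ∈ s, κ i x y) := by
  classical
  induction s using Finset.induction_on with
  | empty => simpa using zero
  | insert i s hi ih =>
    simp only [Finset.sum_insert hi]
    exact (hκ i (Finset.mem_insert_self _ _)).add
      (ih fun j hj => hκ j (Finset.mem_insert_of_mem hj))

/-- $|x-y|^2=\sum_j(x_j^2-2x_jy_j+y_j^2)$ is a finite sum of products of a function of $x$ and a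
function of $y$. -/
theorem dist_sq_mul (hk : IsNuclearKernel D k) :
    IsNuclearKernel D (fun x y => dist x y ^ 2 * k x y) := by
  have hc : ∀ j : Fin d, Continuous fun x : EuclideanSpace ℝ (Fin d) => x j := fun j => by fun_prop
  have h : (fun x y : EuclideanSpace ℝ (Fin d) => dist x y ^ 2 * k x y) = fun x y =>
      ∑ j, ((x j ^ 2 * 1 * k x y + -2 * x j * y j * k x y) + 1 * y j ^ 2 * k x y) := by
    funext x y
    rw [EuclideanSpace.dist_sq_eq, Finset.sum_mul]
    refine Finset.sum_congr rfl fun j _ => ?_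
    rw [Real.dist_eq, sq_abs]
    ring
  rw [h]
  exact sum _ fun j _ => ((hk.mul_left_right ((hc j).pow 2) continuous_const).add
    (hk.mul_left_right ((hc j).const_mul _) (hc j))).add
    (hk.mul_left_right continuous_const ((hc j).pow 2))

theorem dist_pow_mul (hk : IsNuclearKernel D k) (m : ℕ) :
    IsNuclearKernel D (fun x y => dist x y ^ (2 * m) * k x y) := by
  induction m with
  | zero => simpa using hk
  | succ m ih =>
    convert! ih.dist_sq_mul using 3
    ring

end IsNuclearKernel

theorem sum_abs_mul_le {ι : Type*} (s : Finset ι) (A B : ι → ℝ) {α β : ℝ}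
    (hA : ∑ i ∈ s, A i ^ 2 ≤ α) (hB : ∑ i ∈ s, B i ^ 2 ≤ β) :
    ∑ i ∈ s, |A i * B i| ≤ (α + β) / 2 := by
  have : ∑ i ∈ s, |A i * B i| ≤ ∑ i ∈ s, (A i ^ 2 / 2 + B i ^ 2 / 2) :=
    Finset.sum_le_sum fun i _ => by
      rw [abs_mul]
      nlinarith [sq_nonneg (|A i| - |B i|), sq_abs (A i), sq_abs (B i)]
  rw [Finset.sum_add_distrib, ← Finset.sum_div, ← Finset.sum_div] at this
  linarith

theorem integrable_mul_mul (hD : Bornology.IsBounded D) {a b : EuclideanSpace ℝ (Fin d) → ℝ}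
    (ha : Continuous a) (hb : Continuous b) (φ ψ : L2 D) :
    Integrable (fun p : EuclideanSpace ℝ (Fin d) × EuclideanSpace ℝ (Fin d) =>
      (φ p.1 * a p.1) * (ψ p.2 * b p.2)) ((volume.restrict D).prod (volume.restrict D)) :=
  (integrable_L2_mul hD φ ha).mul_prod (integrable_L2_mul hD ψ hb)

/-- The weighted form has rank one, $\langle\varphi,a\rangle\langle\psi,b\rangle$, so Bessel's
inequality for `a` and for `b` suffices. -/
theorem isNuclearKernel_one (hD : Bornology.IsBounded D) :
    IsNuclearKernel D (fun _ _ => 1) := by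
  intro a b ha hb
  have h : ∀ φ ψ : L2 D, formIntegrand a b (fun _ _ => 1) φ ψ =
      fun p => (φ p.1 * a p.1) * (ψ p.2 * b p.2) := fun φ ψ => by
    funext p
    simp only [formIntegrand, mul_one]
  refine ⟨fun φ ψ => ?_, ((∫ x in D, a x ^ 2) + ∫ x in D, b x ^ 2) / 2, fun ι e he s => ?_⟩
  · rw [h]
    exact integrable_mul_mul hD ha hb φ ψ
  · refine le_of_eq_of_le (Finset.sum_congr rfl fun i _ => ?_)
      (sum_abs_mul_le s _ _ (sum_sq_integral_mul_le hD he s ha) (sum_sq_integral_mul_le hD he s hb))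
    rw [form, h, integral_prod_mul (fun x => e i x * a x) fun x => e i x * b x]

/-! ### Gaussian kernels and their averages. -/

theorem integrable_exp_neg_mul_norm_sq {t : ℝ} (ht : 0 < t) :
    Integrable fun z : EuclideanSpace ℝ (Fin d) => Real.exp (-t * ‖z‖ ^ 2) := by
  -- A non-integrable function has integral `0` by convention, so a nonzero integral proves
  -- integrability.
  refine not_imp_comm.1 integral_undef ?_
  rw [GaussianFourier.integral_rexp_neg_mul_sq_norm ht]
  positivity

/-- Completing the square in $z$ around the midpoint of $x$ and $y$, by the parallelogram law.
Integrating over $z$ then leaves a multiple of $e^{-t|x-y|^2}$ with a constant independent of $x$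
and $y$. -/
theorem exp_mul_exp_eq (t : ℝ) (x y z : EuclideanSpace ℝ (Fin d)) :
    Real.exp (-(2 * t) * ‖x - z‖ ^ 2) * Real.exp (-(2 * t) * ‖y - z‖ ^ 2) =
      Real.exp (-t * dist x y ^ 2) *
        Real.exp (-(4 * t) * ‖z - (2⁻¹ : ℝ) • (x + y)‖ ^ 2) := by
  rw [← Real.exp_add, ← Real.exp_add]
  congr 1
  have h := parallelogram_law_with_norm ℝ (x - z) (y - z)
  have h1 : x - z + (y - z) = -((2 : ℝ) • (z - (2⁻¹ : ℝ) • (x + y))) := by module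
  rw [h1, norm_neg, norm_smul, sub_sub_sub_cancel_right, ← dist_eq_norm x y,
    Real.norm_ofNat] at h
  linear_combination t * h

theorem integral_exp_mul_exp {t : ℝ} (ht : 0 < t) (x y : EuclideanSpace ℝ (Fin d)) :
    Integrable (fun z => Real.exp (-(2 * t) * ‖x - z‖ ^ 2) * Real.exp (-(2 * t) * ‖y - z‖ ^ 2)) ∧
    ∫ z, Real.exp (-(2 * t) * ‖x - z‖ ^ 2) * Real.exp (-(2 * t) * ‖y - z‖ ^ 2) =
      Real.exp (-t * dist x y ^ 2) *
        ∫ z : EuclideanSpace ℝ (Fin d), Real.exp (-(4 * t) * ‖z‖ ^ 2) := by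
  simp only [exp_mul_exp_eq]
  have h := integrable_exp_neg_mul_norm_sq (d := d) (t := 4 * t) (by positivity)
  refine ⟨(h.comp_sub_right ((2⁻¹ : ℝ) • (x + y))).const_mul _, ?_⟩
  rw [integral_const_mul,
    integral_sub_right_eq_self (fun z : EuclideanSpace ℝ (Fin d) => Real.exp (-(4 * t) * ‖z‖ ^ 2))]

/-- Fubini's theorem for the convolution representation of a Gaussian kernel. -/
theorem integral_gaussian_swap {α : Type*} [MeasurableSpace α] {ρ : Measure α} [SFinite ρ]
    {w : α → ℝ} (hw : Integrable w ρ) {X Y : α → EuclideanSpace ℝ (Fin d)} (hX : Measurable X)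
    (hY : Measurable Y) {t : ℝ} (ht : 0 < t) :
    Integrable (fun z => ∫ p, w p * (Real.exp (-(2 * t) * ‖X p - z‖ ^ 2) *
      Real.exp (-(2 * t) * ‖Y p - z‖ ^ 2)) ∂ρ) ∧
    ∫ z, ∫ p, w p * (Real.exp (-(2 * t) * ‖X p - z‖ ^ 2) *
      Real.exp (-(2 * t) * ‖Y p - z‖ ^ 2)) ∂ρ =
      (∫ p, w p * Real.exp (-t * dist (X p) (Y p) ^ 2) ∂ρ) *
        ∫ z : EuclideanSpace ℝ (Fin d), Real.exp (-(4 * t) * ‖z‖ ^ 2) := by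
  have hd : Measurable fun p => Real.exp (-t * dist (X p) (Y p) ^ 2) := by fun_prop
  have hint : Integrable (fun q : α × EuclideanSpace ℝ (Fin d) =>
      w q.1 * (Real.exp (-(2 * t) * ‖X q.1 - q.2‖ ^ 2) *
        Real.exp (-(2 * t) * ‖Y q.1 - q.2‖ ^ 2))) (ρ.prod volume) := by
    rw [integrable_prod_iff]
    · refine ⟨Filter.Eventually.of_forall fun p =>
        (integral_exp_mul_exp ht (X p) (Y p)).1.const_mul (w p), ?_⟩
      simp only [norm_mul, Real.norm_eq_abs, Real.abs_exp, integral_const_mul,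
        (integral_exp_mul_exp ht _ _).2]
      simp only [← mul_assoc]
      refine (hw.abs.mul_bdd (c := 1) hd.aestronglyMeasurable ?_).mul_const _
      refine Filter.Eventually.of_forall fun p => ?_
      rw [Real.norm_eq_abs, Real.abs_exp, Real.exp_le_one_iff, neg_mul]
      exact neg_nonpos.2 (by positivity)
    · exact hw.1.comp_fst.mul (by fun_prop : Measurable _).aestronglyMeasurable
  refine ⟨hint.integral_prod_right, ?_⟩
  rw [← integral_integral_swap hint, ← integral_mul_const]
  simp only [integral_const_mul, (integral_exp_mul_exp ht _ _).2, mul_assoc]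

/-- The forms of Gaussian kernels are summable along orthonormal families, uniformly in the
width. -/
theorem sum_abs_form_gaussian_le (hD : Bornology.IsBounded D)
    {a b : EuclideanSpace ℝ (Fin d) → ℝ} (ha : Continuous a) (hb : Continuous b)
    {t : ℝ} (ht : 0 < t) {ι : Type*} {e : ι → L2 D} (he : Orthonormal ℝ e) (s : Finset ι) :
    ∑ i ∈ s, |form a b (fun x y => Real.exp (-t * dist x y ^ 2)) (e i) (e i)| ≤
      ((∫ x in D, a x ^ 2) + ∫ x in D, b x ^ 2) / 2 := by
  set c : ℝ := ∫ z : EuclideanSpace ℝ (Fin d), Real.exp (-(4 * t) * ‖z‖ ^ 2) with hc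
  have hcpos : 0 < c := by
    rw [hc, GaussianFourier.integral_rexp_neg_mul_sq_norm (by positivity)]
    positivity
  let u : EuclideanSpace ℝ (Fin d) → EuclideanSpace ℝ (Fin d) → ℝ :=
    fun z x => Real.exp (-(2 * t) * ‖x - z‖ ^ 2)
  let A : (EuclideanSpace ℝ (Fin d) → ℝ) → ι → EuclideanSpace ℝ (Fin d) → ℝ :=
    fun a i z => ∫ x in D, e i x * (a x * u z x)
  have hsq : ∀ a : EuclideanSpace ℝ (Fin d) → ℝ, Continuous a →
      Integrable (fun z => ∫ x in D, (a x * u z x) ^ 2) ∧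
        ∫ z, ∫ x in D, (a x * u z x) ^ 2 = (∫ x in D, a x ^ 2) * c := fun a ha => by
    -- With both points equal to $x$ the distance vanishes and only the constant `c` remains, so the
    -- bound carries no further dependence on `t`.
    have h := integral_gaussian_swap (memLp_continuous hD ha).integrable_sq measurable_id
      measurable_id ht
    simpa [u, mul_pow, sq (Real.exp _), hc] using h
  have hform : ∀ i, Integrable (fun z => A a i z * A b i z) ∧
      ∫ z, A a i z * A b i z =
        form a b (fun x y => Real.exp (-t * dist x y ^ 2)) (e i) (e i) * c := fun i => by
    have h := integral_gaussian_swap (integrable_mul_mul hD ha hb (e i) (e i)) measurable_fst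
      measurable_snd ht
    have h' : ∀ z, A a i z * A b i z = ∫ p, e i p.1 * a p.1 * (e i p.2 * b p.2) *
        (Real.exp (-(2 * t) * ‖p.1 - z‖ ^ 2) * Real.exp (-(2 * t) * ‖p.2 - z‖ ^ 2))
          ∂((volume.restrict D).prod (volume.restrict D)) := fun z => by
      rw [← integral_prod_mul]
      refine integral_congr_ae (Filter.Eventually.of_forall fun p => ?_)
      simp only [u]
      ring
    simp only [h']
    exact h
  -- For fixed `z`, Bessel against `a * u z` and `b * u z`. Both sides then carry the factor `c`,
  -- which cancels.
  have hle : ∫ z, ∑ i ∈ s, |A a i z * A b i z| ≤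
      ∫ z, ((∫ x in D, (a x * u z x) ^ 2) + ∫ x in D, (b x * u z x) ^ 2) / 2 := by
    refine integral_mono (integrable_finsetSum _ fun i _ => (hform i).1.abs)
      (((hsq a ha).1.add (hsq b hb).1).div_const 2) fun z => ?_
    have hu : Continuous (u z) := by fun_prop
    exact sum_abs_mul_le s _ _ (sum_sq_integral_mul_le hD he s (ha.mul hu))
      (sum_sq_integral_mul_le hD he s (hb.mul hu))
  rw [integral_finsetSum _ fun i _ => (hform i).1.abs, integral_div,
    integral_add (hsq a ha).1 (hsq b hb).1, (hsq a ha).2, (hsq b hb).2, ← add_mul,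
    mul_div_right_comm] at hle
  refine le_of_mul_le_mul_right (le_trans ?_ hle) hcpos
  rw [Finset.sum_mul]
  refine Finset.sum_le_sum fun i _ => ?_
  refine le_of_eq_of_le ?_ abs_integral_le_integral_abs
  rw [(hform i).2, abs_mul, abs_of_pos hcpos]

/-- Averages of Gaussian kernels over their widths are nuclear. -/
theorem isNuclearKernel_integral_gaussian (hD : Bornology.IsBounded D) {S : Set ℝ}
    (hS : MeasurableSet S) (hS0 : S ⊆ Set.Ioi 0) {w : ℝ → ℝ} (hw : IntegrableOn w S) :
    IsNuclearKernel D (fun x y => ∫ t in S, w t * Real.exp (-t * dist x y ^ 2)) := by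
  intro a b ha hb
  have hint : ∀ φ ψ : L2 D, Integrable
      (fun q : (EuclideanSpace ℝ (Fin d) × EuclideanSpace ℝ (Fin d)) × ℝ =>
        (φ q.1.1 * a q.1.1) * (ψ q.1.2 * b q.1.2) * w q.2 *
          Real.exp (-q.2 * dist q.1.1 q.1.2 ^ 2))
      (((volume.restrict D).prod (volume.restrict D)).prod (volume.restrict S)) := fun φ ψ => by
    refine ((integrable_mul_mul hD ha hb φ ψ).mul_prod hw).mul_bdd (c := 1)
      (by fun_prop : Measurable _).aestronglyMeasurable ?_
    have h : ∀ᵐ q ∂(((volume.restrict D).prod (volume.restrict D)).prod (volume.restrict S)),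
        q.2 ∈ S := Measure.quasiMeasurePreserving_snd.ae (ae_restrict_mem hS)
    filter_upwards [h] with q hq
    have := hS0 hq
    rw [Real.norm_eq_abs, Real.abs_exp, Real.exp_le_one_iff, neg_mul]
    exact neg_nonpos.2 (mul_nonneg (le_of_lt this) (sq_nonneg _))
  have heq : ∀ φ ψ : L2 D, formIntegrand a b
      (fun x y => ∫ t in S, w t * Real.exp (-t * dist x y ^ 2)) φ ψ =
      fun p => ∫ t in S, (φ p.1 * a p.1) * (ψ p.2 * b p.2) * w t *
        Real.exp (-t * dist p.1 p.2 ^ 2) := fun φ ψ => by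
    funext p
    simp only [formIntegrand, ← integral_const_mul, mul_assoc]
  have hform : ∀ φ ψ : L2 D, form a b
      (fun x y => ∫ t in S, w t * Real.exp (-t * dist x y ^ 2)) φ ψ =
      ∫ t in S, w t * form a b (fun x y => Real.exp (-t * dist x y ^ 2)) φ ψ := fun φ ψ => by
    rw [form, heq, integral_integral_swap (hint φ ψ)]
    refine integral_congr_ae (Filter.Eventually.of_forall fun t => ?_)
    simp only [form, ← integral_const_mul]
    refine integral_congr_ae (Filter.Eventually.of_forall fun p => ?_)
    simp only [formIntegrand]
    ring
  have hformi : ∀ φ ψ : L2 D, Integrable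
      (fun t => w t * form a b (fun x y => Real.exp (-t * dist x y ^ 2)) φ ψ)
      (volume.restrict S) := fun φ ψ => by
    refine (hint φ ψ).integral_prod_right.congr (Filter.Eventually.of_forall fun t => ?_)
    simp only [form, ← integral_const_mul]
    refine integral_congr_ae (Filter.Eventually.of_forall fun p => ?_)
    simp only [formIntegrand]
    ring
  refine ⟨fun φ ψ => by rw [heq]; exact (hint φ ψ).integral_prod_left,
    (∫ t in S, |w t|) * (((∫ x in D, a x ^ 2) + ∫ x in D, b x ^ 2) / 2), fun ι e he s => ?_⟩
  calc ∑ i ∈ s, |form a b (fun x y => ∫ t in S, w t * Real.exp (-t * dist x y ^ 2)) (e i) (e i)|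
      ≤ ∑ i ∈ s, ∫ t in S,
          |w t * form a b (fun x y => Real.exp (-t * dist x y ^ 2)) (e i) (e i)| :=
        Finset.sum_le_sum fun i _ => by
          rw [hform]
          exact abs_integral_le_integral_abs
    _ = ∫ t in S, ∑ i ∈ s,
          |w t * form a b (fun x y => Real.exp (-t * dist x y ^ 2)) (e i) (e i)| :=
        (integral_finsetSum _ fun i _ => (hformi _ _).abs).symm
    _ ≤ ∫ t in S, |w t| * (((∫ x in D, a x ^ 2) + ∫ x in D, b x ^ 2) / 2) := by
        refine integral_mono_ae (integrable_finsetSum _ fun i _ => (hformi _ _).abs)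
          (hw.abs.mul_const _) ?_
        filter_upwards [ae_restrict_mem hS] with t ht
        simp only [abs_mul, ← Finset.mul_sum]
        exact mul_le_mul_of_nonneg_left (sum_abs_form_gaussian_le hD ha hb (hS0 ht) he s)
          (abs_nonneg _)
    _ = _ := integral_mul_const _ _

/-- A single Gaussian kernel is nuclear. -/
theorem isNuclearKernel_gaussian (hD : Bornology.IsBounded D) {t : ℝ} (ht : 0 < t) :
    IsNuclearKernel D (fun x y => Real.exp (-t * dist x y ^ 2)) := by
  intro a b ha hb
  refine ⟨fun φ ψ => ?_, _, fun ι e he s => sum_abs_form_gaussian_le hD ha hb ht he s⟩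
  refine (integrable_mul_mul hD ha hb φ ψ).mul_bdd (c := 1)
    (by fun_prop : Measurable _).aestronglyMeasurable (Filter.Eventually.of_forall fun p => ?_)
  rw [Real.norm_eq_abs, Real.abs_exp, Real.exp_le_one_iff, neg_mul]
  exact neg_nonpos.2 (by positivity)

end NuclearKernel

/-! ### Fractional powers of the distance as averages of Gaussians. -/

section Power

theorem integrableOn_rpow_mul_exp {S : Set ℝ} (hS : MeasurableSet S) (hS0 : S ⊆ Set.Ioi 0)
    {p ρ : ℝ} (hp : IntegrableOn (fun t : ℝ => t ^ p) S) (hρ : 0 ≤ ρ) :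
    IntegrableOn (fun t : ℝ => t ^ p * Real.exp (-t * ρ)) S := by
  refine hp.mul_bdd (c := 1) (by fun_prop : Measurable _).aestronglyMeasurable ?_
  filter_upwards [ae_restrict_mem hS] with t ht
  rw [Real.norm_eq_abs, Real.abs_exp, Real.exp_le_one_iff, neg_mul]
  exact neg_nonpos.2 (mul_nonneg (le_of_lt (hS0 ht)) hρ)

theorem integrableOn_Ioc_rpow {a : ℝ} (ha : 0 < a) :
    IntegrableOn (fun t : ℝ => t ^ (a - 1)) (Set.Ioc 0 1) :=
  (intervalIntegrable_iff_integrableOn_Ioc_of_le zero_le_one).1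
    (intervalIntegral.intervalIntegrable_rpow' (by linarith))

theorem Ioi_one_subset : Set.Ioi (1 : ℝ) ⊆ Set.Ioi 0 := Set.Ioi_subset_Ioi zero_le_one

theorem integrableOn_Ioi_rpow_mul_exp (p : ℝ) {ρ : ℝ} (hρ : 0 < ρ) :
    IntegrableOn (fun t : ℝ => t ^ p * Real.exp (-t * ρ)) (Set.Ioi 1) := by
  refine integrable_of_isBigO_exp_neg (b := ρ / 2) (by positivity) ?_ ?_
  · refine ContinuousOn.mul (continuousOn_id.rpow_const fun x hx => Or.inl ?_) (by fun_prop)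
    exact (zero_lt_one.trans_le hx).ne'
  · have h2 := (isLittleO_rpow_exp_pos_mul_atTop p (half_pos hρ)).isBigO.mul
      (Asymptotics.isBigO_refl (fun t : ℝ => Real.exp (-t * ρ)) Filter.atTop)
    refine h2.congr_right fun t => ?_
    rw [← Real.exp_add]
    congr 1
    ring

/-- Integration by parts in the upper incomplete Gamma integral. -/
theorem mul_integral_Ioi_rpow_mul_exp {a ρ : ℝ} (ha1 : a < 1) (hρ : 0 ≤ ρ) :
    ρ * ∫ t in Set.Ioi (1 : ℝ), t ^ (a - 1) * Real.exp (-t * ρ) =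
      Real.exp (-ρ) - (1 - a) * ∫ t in Set.Ioi (1 : ℝ), t ^ (a - 2) * Real.exp (-t * ρ) := by
  have hi2 : IntegrableOn (fun t : ℝ => t ^ (a - 2) * Real.exp (-t * ρ)) (Set.Ioi 1) :=
    integrableOn_rpow_mul_exp measurableSet_Ioi Ioi_one_subset
      (integrableOn_Ioi_rpow_of_lt (by linarith) one_pos) hρ
  -- The factor `ρ` stays inside: at `ρ = 0` the power alone need not be integrable, but the product
  -- is zero.
  have hi1 : IntegrableOn (fun t : ℝ => ρ * (t ^ (a - 1) * Real.exp (-t * ρ))) (Set.Ioi 1) := by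
    rcases hρ.eq_or_lt with rfl | hρ
    · simp
    · exact (integrableOn_Ioi_rpow_mul_exp _ hρ).const_mul ρ
  have hderiv : ∀ t ∈ Set.Ici (1 : ℝ), HasDerivAt
      (fun t : ℝ => -(t ^ (a - 1) * Real.exp (-t * ρ)))
      (ρ * (t ^ (a - 1) * Real.exp (-t * ρ)) + (1 - a) * (t ^ (a - 2) * Real.exp (-t * ρ))) t := by
    intro t ht
    have ht0 : t ≠ 0 := (zero_lt_one.trans_le ht).ne'
    have h1 : HasDerivAt (fun t : ℝ => t ^ (a - 1)) ((a - 1) * t ^ (a - 1 - 1)) t :=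
      Real.hasDerivAt_rpow_const (Or.inl ht0)
    have h2 : HasDerivAt (fun t : ℝ => Real.exp (-t * ρ)) (Real.exp (-t * ρ) * (-1 * ρ)) t :=
      ((hasDerivAt_id t).neg.mul_const ρ).exp
    convert! (h1.mul h2).neg using 1
    rw [show a - 1 - 1 = a - 2 by ring]
    ring
  have hlim : Filter.Tendsto (fun t : ℝ => -(t ^ (a - 1) * Real.exp (-t * ρ))) Filter.atTop
      (nhds 0) := by
    rw [← neg_zero]
    refine Filter.Tendsto.neg ?_
    have h0 : Filter.Tendsto (fun t : ℝ => t ^ (a - 1)) Filter.atTop (nhds 0) := by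
      simpa using tendsto_rpow_neg_atTop (y := 1 - a) (by linarith)
    refine squeeze_zero' ?_ ?_ h0
    · filter_upwards [Filter.eventually_ge_atTop 0] with t ht
      positivity
    · filter_upwards [Filter.eventually_ge_atTop 0] with t ht
      refine mul_le_of_le_one_right (by positivity) ?_
      rw [Real.exp_le_one_iff, neg_mul]
      exact neg_nonpos.2 (by positivity)
  have h := integral_Ioi_of_hasDerivAt_of_tendsto' hderiv (hi1.add (hi2.const_mul _)) hlim
  rw [integral_add hi1 (hi2.const_mul _), integral_const_mul, integral_const_mul] at h
  simp only [Real.one_rpow, one_mul, neg_mul] at h ⊢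
  linarith

/-- This is $\rho$ times $\Gamma(a)\rho^{-a}=\int_0^\infty t^{a-1}e^{-t\rho}\,dt$, split at $t=1$.
The weight $t^{a-1}$ is integrable on $(0,1]$ but not at infinity; there integration by parts trades
the factor $\rho$ for the integrable weight $t^{a-2}$. -/
theorem Gamma_mul_rpow_eq {a ρ : ℝ} (ha : 0 < a) (ha1 : a < 1) (hρ : 0 ≤ ρ) :
    Real.Gamma a * ρ ^ (1 - a) =
      ρ * (∫ t in Set.Ioc (0 : ℝ) 1, t ^ (a - 1) * Real.exp (-t * ρ)) +
      (Real.exp (-ρ) + -(1 - a) * ∫ t in Set.Ioi (1 : ℝ), t ^ (a - 2) * Real.exp (-t * ρ)) := by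
  rw [neg_mul, ← sub_eq_add_neg, ← mul_integral_Ioi_rpow_mul_exp ha1 hρ]
  rcases hρ.eq_or_lt with rfl | hρ
  · rw [Real.zero_rpow (by linarith)]
    simp
  · have h := Real.integral_rpow_mul_exp_neg_mul_Ioi ha hρ
    rw [← mul_add, ← setIntegral_union (Set.Ioc_disjoint_Ioi le_rfl) measurableSet_Ioi
      (integrableOn_rpow_mul_exp measurableSet_Ioc (fun t ht => ht.1)
        (integrableOn_Ioc_rpow ha) hρ.le) (integrableOn_Ioi_rpow_mul_exp _ hρ),
      Set.Ioc_union_Ioi_eq_Ioi zero_le_one]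
    have h2 : ∀ t : ℝ, t ^ (a - 1) * Real.exp (-t * ρ) = t ^ (a - 1) * Real.exp (-(ρ * t)) :=
      fun t => by rw [neg_mul, mul_comm t]
    simp only [h2, h]
    rw [Real.rpow_sub hρ, one_div, Real.inv_rpow hρ.le, Real.rpow_one]
    field_simp

variable {d : ℕ} {D : Set (EuclideanSpace ℝ (Fin d))}

/-- Powers of the distance with exponent in `(0, 2)` are nuclear kernels. -/
theorem isNuclearKernel_dist_rpow (hD : Bornology.IsBounded D) {s : ℝ} (hs : 0 < s) (hs2 : s < 2) :
    IsNuclearKernel D (fun x y => dist x y ^ s) := by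
  -- The choice $a=1-s/2$, $\rho=|x-y|^2$ gives $\rho^{1-a}=|x-y|^s$.
  have ha : 0 < 1 - s / 2 := by linarith
  have hΓ := (Real.Gamma_pos_of_pos ha).ne'
  have h : (fun x y : EuclideanSpace ℝ (Fin d) => dist x y ^ s) = fun x y =>
      (Real.Gamma (1 - s / 2))⁻¹ * (dist x y ^ 2 *
        (∫ t in Set.Ioc (0 : ℝ) 1, t ^ (1 - s / 2 - 1) * Real.exp (-t * dist x y ^ 2)) +
      (Real.exp (-1 * dist x y ^ 2) + -(1 - (1 - s / 2)) *
        ∫ t in Set.Ioi (1 : ℝ), t ^ (1 - s / 2 - 2) * Real.exp (-t * dist x y ^ 2))) := by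
    funext x y
    rw [neg_one_mul, ← Gamma_mul_rpow_eq ha (by linarith) (sq_nonneg _), inv_mul_cancel_left₀ hΓ,
      ← Real.rpow_natCast, ← Real.rpow_mul dist_nonneg]
    congr 1
    push_cast
    ring
  rw [h]
  refine IsNuclearKernel.const_mul (.add (.dist_sq_mul ?_) (.add ?_ (.const_mul ?_ _))) _
  · exact isNuclearKernel_integral_gaussian hD measurableSet_Ioc (fun t ht => ht.1)
      (integrableOn_Ioc_rpow ha)
  · exact isNuclearKernel_gaussian hD one_pos
  · exact isNuclearKernel_integral_gaussian hD measurableSet_Ioi Ioi_one_subset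
      (integrableOn_Ioi_rpow_of_lt (by linarith) one_pos)

theorem isNuclearKernel_kernel (hD : Bornology.IsBounded D) {ν ℓ : ℝ} (hν : 0 < ν)
    (hνN : ∀ n : ℕ, ν ≠ n) (hℓ : 0 < ℓ) (σ : ℝ) (N : ℕ) :
    IsNuclearKernel D (fun x y => kernel ν ℓ σ N (dist x y)) := by
  unfold kernel
  refine IsNuclearKernel.const_mul (.sum _ fun k hk => ?_) _
  obtain ⟨m, rfl⟩ : ∃ m, k = m + 1 := ⟨k - 1, by have := (Finset.mem_Icc.1 hk).1; omega⟩
  -- Since `ν` is not a natural number, `2 * (ν - n)` lies strictly between `0` and `2`; the rest of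
  -- the exponent is the even integer `2 * (n + m)`.
  set n := ⌊ν⌋₊
  have hn : (n : ℝ) < ν := lt_of_le_of_ne (Nat.floor_le hν.le) (hνN n).symm
  have hn1 : ν < n + 1 := Nat.lt_floor_add_one ν
  set q : ℝ := √ν / ℓ with hq
  have hq0 : 0 ≤ q := by positivity
  set A : ℝ := 2 ^ (m + 1 - 1) * Real.Gamma ((↑(m + 1) : ℝ) - ν) * (Nat.factorial (m + 1 - 1) : ℝ)
  set B : ℝ := (2 : ℝ) ^ ((↑(m + 1) : ℝ) + ν - 1) * Real.Gamma ((↑(m + 1) : ℝ) + ν) *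
    (Nat.factorial (m + 1 - 1) : ℝ)
  set r : ℝ := 2 * ν + 2 * (↑(m + 1) : ℝ) - 2
  have h : (fun x y : EuclideanSpace ℝ (Fin d) => (√ν * dist x y / ℓ) ^ (2 * (m + 1) - 2) / A -
      (√ν * dist x y / ℓ) ^ r / B) = fun x y =>
      q ^ (2 * m) / A * (dist x y ^ (2 * m) * 1) +
        -(q ^ r / B) * (dist x y ^ (2 * (n + m)) * dist x y ^ (2 * (ν - n))) := by
    funext x y
    have h1 : √ν * dist x y / ℓ = q * dist x y := by rw [hq]; ring
    have h2 : dist x y ^ r = dist x y ^ (2 * (n + m)) * dist x y ^ (2 * (ν - n)) := by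
      rw [← Real.rpow_natCast, ← Real.rpow_add_of_nonneg dist_nonneg (by positivity) (by linarith)]
      congr 1
      simp only [r]
      push_cast
      ring
    rw [h1, mul_pow, Real.mul_rpow hq0 dist_nonneg, h2, show 2 * (m + 1) - 2 = 2 * m by omega]
    ring
  rw [h]
  exact .add (.const_mul ((isNuclearKernel_one hD).dist_pow_mul m) _)
    (.const_mul ((isNuclearKernel_dist_rpow hD (by linarith) (by linarith)).dist_pow_mul _) _)

end Power

/-! ### From nuclear kernels to trace-class integral operators. -/

section Operator

variable {d : ℕ} {D : Set (EuclideanSpace ℝ (Fin d))}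
  {κ : EuclideanSpace ℝ (Fin d) → EuclideanSpace ℝ (Fin d) → ℝ}

theorem coeFn_integralOperator (hD : Bornology.IsBounded D) (hκ : Continuous (Function.uncurry κ))
    (φ : L2 D) : integralOperator hD κ hκ φ =ᵐ[volume.restrict D] fun y => ∫ x in D, φ x * κ x y :=
  (memLp_integral hD hκ φ).coeFn_toLp

theorem inner_integralOperator (hD : Bornology.IsBounded D)
    (hκ : Continuous (Function.uncurry κ)) (hκN : IsNuclearKernel D κ) (φ ψ : L2 D) :
    inner ℝ (integralOperator hD κ hκ φ) ψ = form (fun _ => 1) (fun _ => 1) κ φ ψ := by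
  have hi := (hκN (fun _ => 1) (fun _ => 1) continuous_const continuous_const).1 φ ψ
  rw [form, integral_prod_symm _ hi, L2.inner_def]
  refine integral_congr_ae ?_
  filter_upwards [coeFn_integralOperator hD hκ φ] with y hy
  rw [hy]
  simp only [formIntegrand, mul_one]
  change ψ y * ∫ x in D, φ x * κ x y = _
  rw [← integral_const_mul]
  congr 1
  funext x
  ring

theorem isSymmetric_integralOperator (hD : Bornology.IsBounded D)
    (hκ : Continuous (Function.uncurry κ)) (hκN : IsNuclearKernel D κ)
    (hsymm : ∀ x y, κ x y = κ y x) : (integralOperator hD κ hκ).IsSymmetric := by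
  intro φ ψ
  rw [real_inner_comm (integralOperator hD κ hκ ψ) φ, inner_integralOperator hD hκ hκN, inner_integralOperator hD hκ hκN, form,
    form, ← integral_prod_swap]
  congr 1
  funext p
  simp only [formIntegrand, Prod.fst_swap, Prod.snd_swap, hsymm p.2 p.1]
  ring

/-- The Hilbert-Schmidt bound, which supplies compactness: Bessel against $\kappa(\cdot,y)$ for each
$y$, then integration over $y$. -/
theorem exists_sum_norm_sq_integralOperator_le (hD : Bornology.IsBounded D)
    (hκ : Continuous (Function.uncurry κ)) : ∃ C : ℝ, ∀ {ι : Type} {e : ι → L2 D},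
      Orthonormal ℝ e → ∀ s : Finset ι, ∑ i ∈ s, ‖integralOperator hD κ hκ (e i)‖ ^ 2 ≤ C := by
  have := isFiniteMeasure_restrict hD
  obtain ⟨M, hM⟩ := exists_bound hD hκ
  refine ⟨∫ _ in D, ∫ _ in D, M ^ 2, fun {ι e} he s => ?_⟩
  have h1 : ∀ i, ‖integralOperator hD κ hκ (e i)‖ ^ 2 =
      ∫ y in D, (∫ x in D, e i x * κ x y) ^ 2 := fun i => by
    rw [← real_inner_self_eq_norm_sq, L2.inner_def]
    refine integral_congr_ae ?_
    filter_upwards [coeFn_integralOperator hD hκ (e i)] with y hy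
    rw [hy, real_inner_self_eq_norm_sq, Real.norm_eq_abs, sq_abs]
  have h2 : ∀ i, Integrable (fun y => (∫ x in D, e i x * κ x y) ^ 2) (volume.restrict D) :=
    fun i => (memLp_integral hD hκ (e i)).integrable_sq
  simp only [h1]
  rw [← integral_finsetSum _ fun i _ => h2 i]
  refine integral_mono_ae (integrable_finsetSum _ fun i _ => h2 i) (integrable_const _) ?_
  filter_upwards [ae_mem_closure] with y hy
  have hc : Continuous fun x => κ x y := hκ.comp (by fun_prop : Continuous fun x => (x, y))
  refine (sum_sq_integral_mul_le hD he s hc).trans ?_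
  refine integral_mono_ae (memLp_continuous hD hc).integrable_sq (integrable_const _) ?_
  filter_upwards [ae_mem_closure] with x hx
  exact sq_le_sq.2 ((hM x hx y hy).trans (le_abs_self M))

theorem isTraceClass_integralOperator (hD : Bornology.IsBounded D)
    (hκ : Continuous (Function.uncurry κ)) (hκN : IsNuclearKernel D κ)
    (hsymm : ∀ x y, κ x y = κ y x) (hcont : Continuous (integralOperator hD κ hκ)) :
    IsTraceClass (⟨integralOperator hD κ hκ, hcont⟩ : L2 D →L[ℝ] L2 D) := by
  obtain ⟨C, hC⟩ := (hκN (fun _ => 1) (fun _ => 1) continuous_const continuous_const).2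
  obtain ⟨C', hC'⟩ := exists_sum_norm_sq_integralOperator_le hD hκ
  obtain ⟨w, b, -⟩ := exists_hilbertBasis ℝ (L2 D)
  refine isTraceClass_of_isCompactOperator (C := C) ?_
    (isSymmetric_integralOperator hD hκ hκN hsymm) fun w e he s => ?_
  · exact isCompactOperator_of_summable_norm_sq b _
      (summable_of_sum_le (fun _ => sq_nonneg _) (hC' b.orthonormal))
  · refine le_of_eq_of_le (Finset.sum_congr rfl fun i _ => ?_) (hC w e he s)
    rw [← inner_integralOperator hD hκ hκN]
    rfl

end Operator

end Matern

theorem mainTheorem4 (d : ℕ) (hd1 : 1 ≤ d) (hd3 : d ≤ 3)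
    (D : Set (EuclideanSpace ℝ (Fin d))) (hDo : IsOpen D) (hDb : Bornology.IsBounded D)
    (hDc : IsConnected D)
    (ν ℓ σ : ℝ) (hν : 0 < ν) (hνN : ∀ n : ℕ, ν ≠ (n : ℝ)) (hℓ : 0 < ℓ) (hσ : 0 < σ)
    (N : ℕ) (hN : Even N) :
    ∃ hcont : Continuous (Matern.linearisedOperator hDb hν ℓ σ N),
      IsSelfAdjoint
        (⟨Matern.linearisedOperator hDb hν ℓ σ N, hcont⟩ : Matern.L2 D →L[ℝ] Matern.L2 D) ∧
      Matern.IsTraceClass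
        (⟨Matern.linearisedOperator hDb hν ℓ σ N, hcont⟩ : Matern.L2 D →L[ℝ] Matern.L2 D) := by
  have hnuc := Matern.isNuclearKernel_kernel hDb hν hνN hℓ σ N
  have hsymm : ∀ x y : EuclideanSpace ℝ (Fin d),
      Matern.kernel ν ℓ σ N (dist x y) = Matern.kernel ν ℓ σ N (dist y x) := fun x y => by
    rw [dist_comm]
  have hT : (Matern.linearisedOperator hDb hν ℓ σ N).IsSymmetric :=
    Matern.isSymmetric_integralOperator hDb _ hnuc hsymm
  -- Continuity is the Hellinger-Toeplitz theorem: an everywhere defined symmetric operator is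
  -- bounded.
  exact ⟨hT.continuous, ContinuousLinearMap.isSelfAdjoint_iff_isSymmetric.2 hT,
    Matern.isTraceClass_integralOperator hDb _ hnuc hsymm _⟩
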